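/- Let $h_1,h_2,l_1,l_2,\alpha_1,\alpha_2,\beta,t_1,t_2\in\mathbb R$, put $$\lambda_1=\frac{h_1+h_2-l_1-l_2-\alpha_1-\alpha_2-\beta+2}{2},$$ and for $0<q<1$ let the polynomials $c_n(E)$ in the variable $E$ (the coefficients of the local solution $x^{\lambda_1}\sum_n c_n x^n$ of the $q$-Heun equation with accessory parameter $E$) be determined by $c_{-1}(E)=0$, $c_0(E)=1$ and, for $n\ge 1$, $$\begin{aligned} c_n(E)\, t_1t_2\,q^{h_1+h_2}(1-q^n)(1-q^{n-\beta}) ={}& c_{n-1}(E)\Big[E q^{n-1+\lambda_1}+q^{1/2}(q^{h_1}t_1+q^{h_2}t_2)+(q^{l_1}t_1+q^{l_2}t_2)q^{2(n+\lambda_1)+\alpha_1+\alpha_2-5/2}\Big]\\ &- c_{n-2}(E)\, q(1-q^{n-2+\lambda_1+\alpha_1})(1-q^{n-2+\lambda_1+\alpha_2}).\end{aligned}$$ Write $a(q)\sim b(q)$ if $\lim_{q\to+0}a(q)/b(q)=1$, and for polynomials in $E$ of degree at most $M$ write $\sum_{j=0}^M a_j(q)E^j\sim\sum_{j=0}^M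 b_j(q)E^j$ if $a_j(q)\sim b_j(q)$ for all $j=0,\dots,M$. Assume that $N:=-\lambda_1-\alpha_1$ is a non-negative integer, $\beta<1$, $\alpha_2-\alpha_1<1$, $t_1>0$, $t_2>0$, $h_1<h_2$, $l_1<l_2$, and moreover $1+h_2-l_2-\beta>0$ and $2+2h_2-l_1-l_2-\beta>0$. Then: (i) With $M=N+1$, $$c_{N+1}(E)\sim (t_1t_2)^{-N-1}\,q^{(N/2+\lambda_1-h_1-h_2)(N+1)}\prod_{k=1}^{N+1}\left(E+q^{\,k-N-1/2+h_1-\lambda_1}\,t_1\right).$$ (ii) For every $0<q<1$ the polynomial $c_{N+1}(E)$ has exactly $N+1$ complex roots, all of them real and distinct. Writing them as $E_1(q)<E_2(q)<\dots<E_{N+1}(q)$, one has $$E_k(q)\sim -q^{\,k-N-1/2+h_1-\lambda_1}\,t_1\qquad (k=1,\dots,N+1).$$ -/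

import Mathlib

open Polynomial Filter Topology

/-- The real parameters of the `q`-Heun equation. -/
structure QHeunParams where
  (h₁ h₂ l₁ l₂ α₁ α₂ β t₁ t₂ : ℝ)

namespace QHeunParams

/-- The exponent `λ₁` of the `q`-Heun equation at `x = 0`. -/
noncomputable def lam (P : QHeunParams) : ℝ :=
  (P.h₁ + P.h₂ - P.l₁ - P.l₂ - P.α₁ - P.α₂ - P.β + 2) / 2

/-- The factor multiplying `c_n` in the three term relation. -/
noncomputable def recD (P : QHeunParams) (q : ℝ) (n : ℕ) : ℝ :=
  P.t₁ * P.t₂ * (q ^ (P.h₁ + P.h₂) * (1 - q ^ n) * (1 - q ^ ((n : ℝ) - P.β)))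

/-- The factor multiplying `c_{n-1}` in the three term relation, a polynomial in the accessory
parameter `E` (the indeterminate `X`). -/
noncomputable def recA (P : QHeunParams) (q : ℝ) (n : ℕ) : ℝ[X] :=
  C (q ^ ((n : ℝ) - 1 + P.lam)) * X
    + C (q ^ (1 / 2 : ℝ) * (q ^ P.h₁ * P.t₁ + q ^ P.h₂ * P.t₂)
      + (q ^ P.l₁ * P.t₁ + q ^ P.l₂ * P.t₂)
        * q ^ (2 * ((n : ℝ) + P.lam) + P.α₁ + P.α₂ - 5 / 2))

/-- The factor multiplying `-c_{n-2}` in the three term relation. -/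
noncomputable def recB (P : QHeunParams) (q : ℝ) (n : ℕ) : ℝ :=
  q * (1 - q ^ ((n : ℝ) - 2 + P.lam + P.α₁)) * (1 - q ^ ((n : ℝ) - 2 + P.lam + P.α₂))

/-- The polynomials `c_n(E)`, with `c_0 = 1`, `c_{-1} = 0` and
`recD n * c_n = recA n * c_{n-1} - recB n * c_{n-2}` for `n ≥ 1`. -/
noncomputable def c (P : QHeunParams) (q : ℝ) : ℕ → ℝ[X]
  | 0 => 1
  | 1 => C (P.recD q 1)⁻¹ * P.recA q 1
  | n + 2 => C (P.recD q (n + 2))⁻¹ *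
      (P.recA q (n + 2) * P.c q (n + 1) - C (P.recB q (n + 2)) * P.c q n)

theorem recD_ne_zero (P : QHeunParams) {q : ℝ} (hq0 : 0 < q) (hq1 : q < 1) (ht₁ : 0 < P.t₁)
    (ht₂ : 0 < P.t₂) (hβ : P.β < 1) {n : ℕ} (hn : 1 ≤ n) : P.recD q n ≠ 0 := by
  have hn' : (1 : ℝ) ≤ n := by exact_mod_cast hn
  have h1 : q ^ n < 1 := pow_lt_one₀ hq0.le hq1 (by omega)
  have h2 : q ^ ((n : ℝ) - P.β) < 1 := Real.rpow_lt_one hq0.le hq1 (by linarith)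
  have h3 : 0 < q ^ (P.h₁ + P.h₂) := Real.rpow_pos_of_pos hq0 _
  have h4 : 0 < 1 - q ^ n := by linarith
  have h5 : 0 < 1 - q ^ ((n : ℝ) - P.β) := by linarith
  unfold recD
  positivity

/-- The relation for `n = 1`, where `c_{-1} = 0`. -/
theorem c_one_relation (P : QHeunParams) {q : ℝ} (hq0 : 0 < q) (hq1 : q < 1) (ht₁ : 0 < P.t₁)
    (ht₂ : 0 < P.t₂) (hβ : P.β < 1) :
    C (P.recD q 1) * P.c q 1 = P.recA q 1 * P.c q 0 := by
  have h := P.recD_ne_zero hq0 hq1 ht₁ ht₂ hβ (le_refl 1)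
  rw [c, c, ← mul_assoc, ← C_mul, mul_inv_cancel₀ h, C_1, one_mul, mul_one]

/-- The three term relation for `n + 2`. -/
theorem c_relation (P : QHeunParams) {q : ℝ} (hq0 : 0 < q) (hq1 : q < 1) (ht₁ : 0 < P.t₁)
    (ht₂ : 0 < P.t₂) (hβ : P.β < 1) (n : ℕ) :
    C (P.recD q (n + 2)) * P.c q (n + 2) =
      P.recA q (n + 2) * P.c q (n + 1) - C (P.recB q (n + 2)) * P.c q n := by
  have h := P.recD_ne_zero hq0 hq1 ht₁ ht₂ hβ (show 1 ≤ n + 2 by omega)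
  rw [c, ← mul_assoc, ← C_mul, mul_inv_cancel₀ h, C_1, one_mul]

end QHeunParams

/-- `a(q) ∼ b(q)` as `q → +0`: the quotient tends to `1`. -/
def UDEquiv (a b : ℝ → ℝ) : Prop :=
  Tendsto (fun q => a q / b q) (𝓝[>] 0) (𝓝 1)

/-- Coefficientwise equivalence as `q → +0` of two families `∑_{j=0}^M a_j(q) E^j` and
`∑_{j=0}^M b_j(q) E^j` of polynomials of degree at most `M`. -/
def UDPolyEquiv (M : ℕ) (p r : ℝ → ℝ[X]) : Prop :=
  (∀ q ∈ Set.Ioo (0 : ℝ) 1, (p q).natDegree ≤ M ∧ (r q).natDegree ≤ M) ∧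
    ∀ j ≤ M, UDEquiv (fun q => (p q).coeff j) (fun q => (r q).coeff j)

/-! After division by `recD`, the relation reads `p (n+1) = (u n X + v n) p n - w n p (n-1)`. As q →
0, `u n` has order q^(n+a) and `v n` order q^b, with a = λ₁ - h₁ - h₂ and b = 1/2 - h₂, while `w n`
is o(q^(2b)) for n ≥ 1, too small to affect any leading term. The coefficients therefore have the
leading terms of ∏ (u i X + v i). In its j-th coefficient the choice of u from the first j factors
alone has minimal order, and its constant is positive, so nothing cancels (`ttr.hasLead_coeff`).
This gives (i).

For 0 < q < 1 the u and the relevant w are positive, so the zeros are real and simple, as for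
orthogonal polynomials (`ttr.exists_strictMono_roots`). The Newton polygon of the coefficients has
N+1 edges of length one. On the scale of an edge only its two end terms survive and they change
sign, which places a zero near each predicted point (`eventually_exists_root`). For small q these
N+1 zeros are ordered, hence they are all the zeros. -/

/-! ### Three term recurrences: coefficients, reality and simplicity of zeros. -/

/-- The polynomials with `p 0 = 1`, `p 1 = u 0 X + v 0` and
`p (n + 2) = (u (n + 1) X + v (n + 1)) p (n + 1) - w (n + 1) p n`. -/
noncomputable def ttr (u v w : ℕ → ℝ) : ℕ → ℝ[X]
  | 0 => 1
  | 1 => C (u 0) * X + C (v 0)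
  | n + 2 => (C (u (n + 1)) * X + C (v (n + 1))) * ttr u v w (n + 1) - C (w (n + 1)) * ttr u v w n

namespace ttr

variable {u v w : ℕ → ℝ}

theorem coeff_zero_succ (n : ℕ) :
    (ttr u v w (n + 2)).coeff 0 =
      v (n + 1) * (ttr u v w (n + 1)).coeff 0 - w (n + 1) * (ttr u v w n).coeff 0 := by
  simp [ttr, add_mul, mul_assoc]

theorem coeff_succ_succ (n j : ℕ) :
    (ttr u v w (n + 2)).coeff (j + 1) =
      u (n + 1) * (ttr u v w (n + 1)).coeff j + v (n + 1) * (ttr u v w (n + 1)).coeff (j + 1)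
        - w (n + 1) * (ttr u v w n).coeff (j + 1) := by
  simp [ttr, add_mul, mul_assoc]

theorem natDegree_le : ∀ n, (ttr u v w n).natDegree ≤ n
  | 0 => by simp [ttr]
  | 1 => natDegree_linear_le
  | n + 2 => by
    have h1 : (ttr u v w n).natDegree ≤ n := natDegree_le n
    have h2 : (ttr u v w (n + 1)).natDegree ≤ n + 1 := natDegree_le (n + 1)
    have h3 : (C (u (n + 1)) * X + C (v (n + 1))).natDegree ≤ 1 := natDegree_linear_le
    refine (natDegree_sub_le _ _).trans (max_le ?_ ?_)
    · exact (natDegree_mul_le).trans (by omega)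
    · exact (natDegree_C_mul_le _ _).trans (by omega)

theorem coeff_self : ∀ n, (ttr u v w n).coeff n = ∏ i ∈ Finset.range n, u i
  | 0 => by simp [ttr]
  | 1 => by simp [ttr]
  | n + 2 => by
    rw [coeff_succ_succ, coeff_self (n + 1), Finset.prod_range_succ _ (n + 1),
      coeff_eq_zero_of_natDegree_lt (lt_of_le_of_lt (natDegree_le (n + 1)) (by omega)),
      coeff_eq_zero_of_natDegree_lt (lt_of_le_of_lt (natDegree_le n) (by omega))]
    ring

theorem eq_prod_of_w_eq_zero : ∀ n, ttr u v 0 n = ∏ i ∈ Finset.range n, (C (u i) * X + C (v i))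
  | 0 => by simp [ttr]
  | 1 => by simp [ttr]
  | n + 2 => by
    rw [ttr, eq_prod_of_w_eq_zero (n + 1), Finset.prod_range_succ _ (n + 1),
      Pi.zero_apply, C_0, zero_mul, sub_zero, mul_comm]

theorem natDegree_eq {n : ℕ} (hu : ∀ i < n, 0 < u i) : (ttr u v w n).natDegree = n := by
  refine le_antisymm (natDegree_le n) (le_natDegree_of_ne_zero ?_)
  rw [coeff_self]
  exact (Finset.prod_pos fun i hi => hu i (Finset.mem_range.1 hi)).ne'

theorem ne_zero {n : ℕ} (hu : ∀ i < n, 0 < u i) : ttr u v w n ≠ 0 := by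
  intro h
  have := coeff_self (u := u) (v := v) (w := w) n
  rw [h, coeff_zero] at this
  exact (Finset.prod_pos fun i hi => hu i (Finset.mem_range.1 hi)).ne this

/-- The Wronskian of consecutive polynomials is positive on the real line. -/
theorem wronskian_pos (x : ℝ) : ∀ n, (∀ i ≤ n, 0 < u i) → (∀ i, 1 ≤ i → i ≤ n → 0 < w i) →
    0 < (derivative (ttr u v w (n + 1))).eval x * (ttr u v w n).eval x
      - (ttr u v w (n + 1)).eval x * (derivative (ttr u v w n)).eval x
  | 0, hu, _ => by simpa [ttr] using hu 0 le_rfl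
  | n + 1, hu, hw => by
    have ih := wronskian_pos x n (fun i hi => hu i (by omega)) (fun i h hi => hw i h (by omega))
    have hu' := hu (n + 1) le_rfl
    have hw' := hw (n + 1) (by omega) le_rfl
    -- The Wronskians satisfy W (n+1) = u (n+1) p (n+1)² + w (n+1) W n.
    have key := mul_nonneg hu'.le (sq_nonneg ((ttr u v w (n + 1)).eval x))
    have := mul_pos hw' ih
    rw [ttr]
    simp only [derivative_sub, derivative_mul, derivative_add, derivative_C, derivative_X,
      eval_sub, eval_mul, eval_add, eval_C, eval_X, eval_zero, eval_one]
    nlinarith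

/-- `Im (p (n + 1) (z) * conj (p n (z)))` has the sign of `Im z`. -/
theorem im_mul_conj_pos (z : ℂ) (hz : z.im ≠ 0) : ∀ n, (∀ i ≤ n, 0 < u i) →
    (∀ i, 1 ≤ i → i ≤ n → 0 < w i) →
    0 < z.im * ((aeval z (ttr u v w (n + 1))).im * (aeval z (ttr u v w n)).re
      - (aeval z (ttr u v w (n + 1))).re * (aeval z (ttr u v w n)).im)
  | 0, hu, _ => by
    have := mul_pos (hu 0 le_rfl) (mul_self_pos.2 hz)
    simp [ttr]
    linarith
  | n + 1, hu, hw => by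
    have ih := im_mul_conj_pos z hz n (fun i hi => hu i (by omega))
      (fun i h hi => hw i h (by omega))
    have hu' := hu (n + 1) le_rfl
    have hw' := hw (n + 1) (by omega) le_rfl
    have h1 := mul_pos hw' ih
    -- Im (p (n+2) conj p (n+1)) = u Im z |p (n+1)|² + w Im (p (n+1) conj p n), with u and w at
    -- index n+1.
    have h2 := mul_nonneg (mul_nonneg hu'.le (sq_nonneg z.im))
      (add_nonneg (sq_nonneg (aeval z (ttr u v w (n + 1))).re)
        (sq_nonneg (aeval z (ttr u v w (n + 1))).im))
    rw [ttr]
    simp only [map_sub, map_mul, map_add, aeval_C, aeval_X, Complex.coe_algebraMap, Complex.sub_re,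
      Complex.sub_im, Complex.mul_re, Complex.mul_im, Complex.add_re, Complex.add_im,
      Complex.ofReal_re, Complex.ofReal_im]
    nlinarith

/-- A three term recurrence with positive coefficients has only real and simple zeros. -/
theorem exists_strictMono_roots (n : ℕ) (hu : ∀ i < n, 0 < u i)
    (hw : ∀ i, 1 ≤ i → i < n → 0 < w i) :
    ∃ e : Fin n → ℝ, StrictMono e ∧
      ∀ z : ℂ, aeval z (ttr u v w n) = 0 ↔ ∃ k, z = (e k : ℂ) := by
  have hp0 := ne_zero (v := v) (w := w) hu
  have hdeg := natDegree_eq (v := v) (w := w) hu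
  have him : ∀ z : ℂ, aeval z (ttr u v w n) = 0 → z.im = 0 := by
    intro z hz
    by_contra him
    rcases n with _ | n
    · simp [ttr] at hz
    · have := im_mul_conj_pos (v := v) z him n (fun i hi => hu i (by omega))
        (fun i h hi => hw i h (by omega))
      simp [hz] at this
  set f : ℂ[X] := (ttr u v w n).map (algebraMap ℝ ℂ) with hf
  have hf0 : f ≠ 0 := (Polynomial.map_ne_zero_iff (algebraMap ℝ ℂ).injective).2 hp0
  have hroot : ∀ z, z ∈ f.roots ↔ aeval z (ttr u v w n) = 0 := fun z => by
    rw [mem_roots hf0, IsRoot.def, hf, eval_map_algebraMap]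
  have hnodup : f.roots.Nodup := by
    rw [Multiset.nodup_iff_count_le_one]
    intro z
    rw [count_roots]
    by_contra! hlt
    obtain ⟨h1, h2⟩ := (one_lt_rootMultiplicity_iff_isRoot hf0).1 hlt
    have hz := (hroot z).1 ((mem_roots hf0).2 h1)
    obtain ⟨x, rfl⟩ : ∃ x : ℝ, z = x := ⟨z.re, Complex.ext rfl (by simpa using him z hz)⟩
    rw [IsRoot.def, hf, derivative_map, eval_map_algebraMap] at h2
    change aeval (algebraMap ℝ ℂ x) _ = 0 at h2
    change aeval (algebraMap ℝ ℂ x) _ = 0 at hz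
    rw [aeval_algebraMap_apply_eq_algebraMap_eval,
      map_eq_zero_iff _ (algebraMap ℝ ℂ).injective] at h2 hz
    rcases n with _ | n
    · simp [ttr] at hz
    · have := wronskian_pos (v := v) x n (fun i hi => hu i (by omega))
        (fun i h hi => hw i h (by omega))
      simp [hz, h2] at this
  -- All roots are real, so taking real parts is injective on them and `T` has n elements.
  set T := f.roots.toFinset.image Complex.re with hT
  have hcard : T.card = n := by
    rw [hT, Finset.card_image_of_injOn, Multiset.toFinset_card_of_nodup hnodup,
      IsAlgClosed.card_roots_eq_natDegree, hf, natDegree_map, hdeg]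
    intro a ha b hb hab
    have ha' := him a ((hroot a).1 (by simpa using ha))
    have hb' := him b ((hroot b).1 (by simpa using hb))
    exact Complex.ext hab (by rw [ha', hb'])
  refine ⟨T.orderEmbOfFin hcard, (T.orderEmbOfFin hcard).strictMono, fun z => ?_⟩
  have hmem : ∀ x : ℝ, x ∈ T ↔ ∃ k, T.orderEmbOfFin hcard k = x := fun x => by
    rw [← Set.mem_range, Finset.range_orderEmbOfFin, Finset.mem_coe]
  constructor
  · intro hz
    obtain ⟨k, hk⟩ := (hmem z.re).1
      (Finset.mem_image.2 ⟨z, Multiset.mem_toFinset.2 ((hroot z).2 hz), rfl⟩)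
    exact ⟨k, Complex.ext (by simp [hk]) (by simpa using him z hz)⟩
  · rintro ⟨k, rfl⟩
    obtain ⟨y, hy, hyk⟩ := Finset.mem_image.1 ((hmem _).2 ⟨k, rfl⟩)
    have hy' := (hroot y).1 (Multiset.mem_toFinset.1 hy)
    rwa [← hyk, show ((y.re : ℝ) : ℂ) = y from Complex.ext rfl (by simpa using (him y hy').symm)]

end ttr

/-- Two increasing lists of `n` zeros of a nonzero polynomial of degree at most `n` agree. -/
theorem strictMono_roots_unique {n : ℕ} {p : ℝ[X]} (hp : p ≠ 0) (hdeg : p.natDegree ≤ n)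
    {e f : Fin n → ℝ} (he : StrictMono e) (hf : StrictMono f) (her : ∀ k, p.IsRoot (e k))
    (hfr : ∀ k, p.IsRoot (f k)) : e = f := by
  have key : ∀ {g : Fin n → ℝ}, StrictMono g → (∀ k, p.IsRoot (g k)) →
      Finset.univ.image g = p.roots.toFinset := by
    intro g hg hgr
    refine Finset.eq_of_subset_of_card_le ?_ ?_
    · intro x hx
      obtain ⟨k, -, rfl⟩ := Finset.mem_image.1 hx
      exact Multiset.mem_toFinset.2 ((mem_roots hp).2 (hgr k))
    · rw [Finset.card_image_of_injective _ hg.injective, Finset.card_univ, Fintype.card_fin]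
      exact (Multiset.toFinset_card_le _).trans ((card_roots' p).trans hdeg)
  refine (he.range_inj hf).1 ?_
  have := (key he her).trans (key hf hfr).symm
  simpa using congrArg (fun s : Finset ℝ => (s : Set ℝ)) this

/-! ### Calculus of leading powers of q. -/

/-- `f q = (K + o(1)) q ^ e` as `q → +0`. -/
def HasLead (f : ℝ → ℝ) (e K : ℝ) : Prop :=
  Tendsto (fun q => f q / q ^ e) (𝓝[>] 0) (𝓝 K)

theorem eventually_mem_Ioo_zero_one : ∀ᶠ q : ℝ in 𝓝[>] 0, q ∈ Set.Ioo (0 : ℝ) 1 :=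
  Ioo_mem_nhdsGT one_pos

theorem tendsto_rpow_nhdsGT_zero {s : ℝ} (hs : 0 < s) :
    Tendsto (fun q : ℝ => q ^ s) (𝓝[>] 0) (𝓝 0) := by
  have := (Real.continuousAt_rpow_const 0 s (Or.inr hs.le)).tendsto
  rw [Real.zero_rpow hs.ne'] at this
  exact this.mono_left nhdsWithin_le_nhds

namespace HasLead

variable {f g : ℝ → ℝ} {e e' K L : ℝ}

theorem congr' (hf : HasLead f e K) (h : ∀ q ∈ Set.Ioo (0 : ℝ) 1, f q = g q) : HasLead g e K := by
  refine Tendsto.congr' ?_ hf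
  filter_upwards [eventually_mem_Ioo_zero_one] with q hq
  rw [h q hq]

theorem cast (hf : HasLead f e K) (he : e = e') (hK : K = L) : HasLead f e' L := he ▸ hK ▸ hf

theorem rpow (e : ℝ) : HasLead (fun q => q ^ e) e 1 := by
  refine Tendsto.congr' ?_ tendsto_const_nhds
  filter_upwards [eventually_mem_Ioo_zero_one] with q hq
  exact (div_self (Real.rpow_pos_of_pos hq.1 _).ne').symm

theorem of_tendsto (h : Tendsto f (𝓝[>] 0) (𝓝 K)) : HasLead f 0 K := by
  simpa [HasLead] using h

theorem const (K : ℝ) : HasLead (fun _ => K) 0 K := of_tendsto tendsto_const_nhds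

theorem zero (e : ℝ) : HasLead (fun _ => 0) e 0 := by simp [HasLead]

theorem mul (hf : HasLead f e K) (hg : HasLead g e' L) :
    HasLead (fun q => f q * g q) (e + e') (K * L) := by
  refine Tendsto.congr' ?_ (Tendsto.mul hf hg)
  filter_upwards [eventually_mem_Ioo_zero_one] with q hq
  rw [Real.rpow_add hq.1, mul_div_mul_comm]

theorem inv (hf : HasLead f e K) (hK : K ≠ 0) : HasLead (fun q => (f q)⁻¹) (-e) K⁻¹ := by
  refine Tendsto.congr' ?_ (Tendsto.inv₀ hf hK)
  filter_upwards [eventually_mem_Ioo_zero_one] with q hq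
  rw [Real.rpow_neg hq.1.le, inv_div, div_inv_eq_mul, mul_comm, div_eq_mul_inv]

theorem add (hf : HasLead f e K) (hg : HasLead g e L) :
    HasLead (fun q => f q + g q) e (K + L) := by
  simpa only [HasLead, add_div] using Tendsto.add hf hg

theorem sub (hf : HasLead f e K) (hg : HasLead g e L) :
    HasLead (fun q => f q - g q) e (K - L) := by
  simpa only [HasLead, sub_div] using Tendsto.sub hf hg

theorem sum {ι : Type*} (s : Finset ι) {f : ι → ℝ → ℝ} {K : ι → ℝ}
    (h : ∀ i ∈ s, HasLead (f i) e (K i)) :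
    HasLead (fun q => ∑ i ∈ s, f i q) e (∑ i ∈ s, K i) := by
  simpa only [HasLead, Finset.sum_div] using tendsto_finsetSum s h

/-- The constant 0 encodes negligibility: a term of higher order can be added at order e' without
changing the leading constant. -/
theorem of_lt (hf : HasLead f e K) (h : e' < e) : HasLead f e' 0 := by
  have := Tendsto.mul hf (tendsto_rpow_nhdsGT_zero (sub_pos.2 h))
  rw [mul_zero] at this
  refine Tendsto.congr' ?_ this
  filter_upwards [eventually_mem_Ioo_zero_one] with q hq
  have := (Real.rpow_pos_of_pos hq.1 e).ne'
  rw [Real.rpow_sub hq.1]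
  field_simp

theorem udEquiv (hf : HasLead f e K) (hg : HasLead g e K) (hK : K ≠ 0) : UDEquiv f g := by
  have := Tendsto.div hf hg hK
  rw [div_self hK] at this
  refine Tendsto.congr' ?_ this
  filter_upwards [eventually_mem_Ioo_zero_one] with q hq
  exact div_div_div_cancel_right₀ (Real.rpow_pos_of_pos hq.1 e).ne' _ _

theorem one_sub_rpow {s : ℝ} (hs : 0 < s) : HasLead (fun q => 1 - q ^ s) 0 1 := by
  simpa using (const 1).sub ((rpow s).of_lt hs)

theorem one_sub_rpow_neg {s : ℝ} (hs : s < 0) : HasLead (fun q => 1 - q ^ s) s (-1) := by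
  simpa using ((const 1).of_lt hs).sub (rpow s)

end HasLead

/-! ### Newton polygon of the coefficients and location of the zeros. -/

/-- The exponent of `q` in the leading term of the `j`-th coefficient of the `n`-th polynomial. -/
noncomputable def leadExp (a b : ℝ) (n j : ℕ) : ℝ :=
  (j : ℝ) * (j - 1) / 2 + j * a + ((n : ℝ) - j) * b

/-- Leading terms of the coefficients of a three term recurrence whose last term is negligible. -/
theorem ttr.hasLead_coeff {u v w : ℝ → ℕ → ℝ} {a b U V : ℝ} {M : ℕ}
    (hu : ∀ n < M, HasLead (fun q => u q n) (n + a) U)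
    (hv : ∀ n < M, HasLead (fun q => v q n) b V)
    (hw : ∀ n, 1 ≤ n → n < M → HasLead (fun q => w q n) (2 * b) 0) :
    ∀ n ≤ M, ∀ j, HasLead (fun q => (ttr (u q) (v q) (w q) n).coeff j) (leadExp a b n j)
      (if j ≤ n then U ^ j * V ^ (n - j) else 0)
  | 0, _, 0 => by simpa [ttr, leadExp] using HasLead.const 1
  | 0, _, j + 1 => by
    simpa [ttr, coeff_one] using HasLead.zero _
  | 1, hM, 0 => by
    refine ((hv 0 (by omega)).congr' ?_).cast (by simp [leadExp]) (by simp)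
    simp [ttr]
  | 1, hM, 1 => by
    refine ((hu 0 (by omega)).congr' ?_).cast (by simp [leadExp]) (by simp)
    simp [ttr]
  | 1, hM, j + 2 => by
    simpa [ttr, coeff_X, coeff_C] using HasLead.zero _
  | n + 2, hM, 0 => by
    have h1 := (hv (n + 1) (by omega)).mul (ttr.hasLead_coeff hu hv hw (n + 1) (by omega) 0)
    have h2 := (hw (n + 1) (by omega) (by omega)).mul
      (ttr.hasLead_coeff hu hv hw n (by omega) 0)
    simp only [ttr.coeff_zero_succ]
    refine (h1.cast ?_ rfl).sub (h2.cast ?_ rfl) |>.cast rfl ?_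
    · simp only [leadExp]; push_cast; ring
    · simp only [leadExp]; push_cast; ring
    · simp; ring
  | n + 2, hM, j + 1 => by
    have h1 := (hv (n + 1) (by omega)).mul (ttr.hasLead_coeff hu hv hw (n + 1) (by omega) (j + 1))
    have h2 := (hw (n + 1) (by omega) (by omega)).mul
      (ttr.hasLead_coeff hu hv hw n (by omega) (j + 1))
    have h3 := (hu (n + 1) (by omega)).mul (ttr.hasLead_coeff hu hv hw (n + 1) (by omega) j)
    have h2' := h2.cast (e' := leadExp a b (n + 2) (j + 1)) (by simp only [leadExp]; push_cast; ring)
      (zero_mul _)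
    have h1' := h1.cast (e' := leadExp a b (n + 2) (j + 1)) (by simp only [leadExp]; push_cast; ring)
      rfl
    simp only [ttr.coeff_succ_succ]
    rcases lt_trichotomy j (n + 1) with hj | rfl | hj
    · have hj' : (j : ℝ) < n + 1 := by exact_mod_cast hj
      -- The exponent of the u-term exceeds the target by n + 1 - j, so below the top degree only
      -- the v-term contributes.
      have h3' := h3.of_lt (e' := leadExp a b (n + 2) (j + 1))
        (by simp only [leadExp]; push_cast; nlinarith)
      refine ((h3'.add h1').sub h2').cast rfl ?_
      rw [if_pos (by omega), if_pos (by omega), show n + 2 - (j + 1) = n + 1 - (j + 1) + 1 by omega]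
      ring
    · refine ((((h3.cast ?_ rfl).add h1').sub h2')).cast rfl ?_
      · simp only [leadExp]; push_cast; ring
      · simp; ring
    · have hz : ∀ q, (ttr (u q) (v q) (w q) (n + 1)).coeff j = 0 := fun q =>
        coeff_eq_zero_of_natDegree_lt (lt_of_le_of_lt (ttr.natDegree_le _) hj)
      simp only [hz, mul_zero]
      refine (((HasLead.zero _).add h1').sub h2').cast rfl ?_
      rw [if_neg (by omega), if_neg (by omega)]
      simp

/-- Evaluation at a point of the scale of the `k`-th zero: only two coefficients contribute. -/
theorem hasLead_eval_of_hasLead_coeff {p : ℝ → ℝ[X]} {a b t V : ℝ} {N : ℕ} (ht : t ≠ 0)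
    (hdeg : ∀ q, (p q).natDegree ≤ N + 1)
    (hp : ∀ j ≤ N + 1, HasLead (fun q => (p q).coeff j) (leadExp a b (N + 1) j)
      ((V / t) ^ j * V ^ (N + 1 - j))) (k : Fin (N + 1)) (x : ℝ) :
    HasLead (fun q => (p q).eval (-x * (q ^ ((k : ℝ) - N + b - a) * t)))
      (leadExp a b (N + 1) (N - k) + (N - k : ℕ) * ((k : ℝ) - N + b - a))
      (V ^ (N + 1) * (-x) ^ (N - k : ℕ) * (1 - x)) := by
  have hk : (k : ℕ) ≤ N := by omega
  have hterm : ∀ j ∈ Finset.range (N + 2), HasLead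
      (fun q => (p q).coeff j * (-x * (q ^ ((k : ℝ) - N + b - a) * t)) ^ j)
      (leadExp a b (N + 1) (N - k) + (N - k : ℕ) * ((k : ℝ) - N + b - a))
      (if j = N - k then V ^ (N + 1) * (-x) ^ j
        else if j = N - k + 1 then V ^ (N + 1) * (-x) ^ j else 0) := by
    intro j hj
    have hj' : j ≤ N + 1 := by rw [Finset.mem_range] at hj; omega
    have h1 := (hp j hj').mul ((HasLead.rpow (j * ((k : ℝ) - N + b - a))).mul
      (HasLead.const ((-x * t) ^ j)))
    have h2 : HasLead (fun q => (p q).coeff j * (-x * (q ^ ((k : ℝ) - N + b - a) * t)) ^ j)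
        (leadExp a b (N + 1) j + j * ((k : ℝ) - N + b - a)) (V ^ (N + 1) * (-x) ^ j) := by
      refine (h1.congr' fun q hq => ?_).cast (by ring) ?_
      · rw [mul_comm (j : ℝ), Real.rpow_mul hq.1.le, Real.rpow_natCast, ← mul_pow]
        ring_nf
      · rw [← pow_mul_pow_sub V hj', div_pow, mul_pow]
        field_simp
    -- The excess d(d-1)/2 with d = j - (N - k) vanishes at d = 0, 1 and is positive at every other
    -- integer.
    have hexp : leadExp a b (N + 1) j + j * ((k : ℝ) - N + b - a)
        = leadExp a b (N + 1) (N - k) + (N - k : ℕ) * ((k : ℝ) - N + b - a)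
          + ((j : ℝ) - (N - k)) * ((j : ℝ) - (N - k) - 1) / 2 := by
      simp only [leadExp, Nat.cast_sub hk]
      push_cast
      ring
    have hkN : ((N - k : ℕ) : ℝ) = N - k := Nat.cast_sub hk
    split_ifs with h h'
    · refine h2.cast ?_ rfl
      rw [hexp, ← hkN, h]
      ring
    · refine h2.cast ?_ rfl
      rw [hexp, ← hkN, h']
      push_cast
      ring
    · refine h2.of_lt ?_
      rw [hexp, ← hkN]
      rcases lt_or_gt_of_ne h with hlt | hgt
      · have : (j : ℝ) + 1 ≤ (N - k : ℕ) := by exact_mod_cast hlt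
        nlinarith
      · have : ((N - k : ℕ) : ℝ) + 2 ≤ j := by exact_mod_cast (by omega : N - k + 2 ≤ j)
        nlinarith
  refine ((HasLead.sum _ hterm).congr' fun q _ => ?_).cast rfl ?_
  · rw [eval_eq_sum_range' (Nat.lt_succ_of_le (hdeg q))]
  · rw [← Finset.add_sum_erase _ _ (Finset.mem_range.2 (by omega : N - (k : ℕ) < N + 2)),
      if_pos rfl, Finset.sum_eq_single (N - (k : ℕ) + 1)]
    · simp; ring
    · intro j hj hne
      rw [if_neg (Finset.ne_of_mem_erase hj), if_neg hne]
    · intro h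
      exact absurd (Finset.mem_erase.2 ⟨by omega, Finset.mem_range.2 (by omega)⟩) h

/-- Near every point of the Newton polygon scale there is a zero. -/
theorem eventually_exists_root {p : ℝ → ℝ[X]} {a b t V : ℝ} {N : ℕ} (ht : 0 < t) (hV : 0 < V)
    (hdeg : ∀ q, (p q).natDegree ≤ N + 1)
    (hp : ∀ j ≤ N + 1, HasLead (fun q => (p q).coeff j) (leadExp a b (N + 1) j)
      ((V / t) ^ j * V ^ (N + 1 - j))) (k : Fin (N + 1)) {ε : ℝ} (hε : 0 < ε) (hε1 : ε < 1) :
    ∀ᶠ q in 𝓝[>] 0, ∃ x ∈ Set.Icc (1 - ε) (1 + ε),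
      (p q).IsRoot (-x * (q ^ ((k : ℝ) - N + b - a) * t)) := by
  have h1 := hasLead_eval_of_hasLead_coeff ht.ne' hdeg hp k (1 - ε)
  have h2 := hasLead_eval_of_hasLead_coeff ht.ne' hdeg hp k (1 + ε)
  have h3 := h1.mul h2
  have hneg : V ^ (N + 1) * (-(1 - ε)) ^ (N - k : ℕ) * (1 - (1 - ε)) *
      (V ^ (N + 1) * (-(1 + ε)) ^ (N - k : ℕ) * (1 - (1 + ε))) < 0 := by
    have : 0 < (V ^ (N + 1)) ^ 2 * ((1 - ε) * (1 + ε)) ^ (N - k : ℕ) * ε ^ 2 := by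
      have : 0 < 1 - ε := by linarith
      positivity
    have h4 : ((1 - ε) * (1 + ε)) ^ (N - k : ℕ)
        = (-(1 - ε)) ^ (N - k : ℕ) * (-(1 + ε)) ^ (N - k : ℕ) := by
      rw [← mul_pow]; ring_nf
    rw [h4] at this
    linarith
  filter_upwards [eventually_mem_Ioo_zero_one, h3.eventually_lt_const hneg] with q hq hlt
  have hlt' := (div_neg_iff.1 hlt).resolve_left
    fun h => absurd h.2 (Real.rpow_pos_of_pos hq.1 _).not_gt
  have hcont : ContinuousOn (fun x => (p q).eval (-x * (q ^ ((k : ℝ) - N + b - a) * t)))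
      (Set.uIcc (1 - ε) (1 + ε)) := by fun_prop
  have hmem : (0 : ℝ) ∈ Set.uIcc ((p q).eval (-(1 - ε) * (q ^ ((k : ℝ) - N + b - a) * t)))
      ((p q).eval (-(1 + ε) * (q ^ ((k : ℝ) - N + b - a) * t))) := by
    rw [Set.mem_uIcc]
    rcases mul_neg_iff.1 hlt'.1 with h | h
    · exact Or.inr ⟨h.2.le, h.1.le⟩
    · exact Or.inl ⟨h.1.le, h.2.le⟩
  obtain ⟨x, hx, hx0⟩ := intermediate_value_uIcc hcont hmem
  rw [Set.uIcc_of_le (by linarith)] at hx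
  exact ⟨x, hx, hx0⟩

/-- The zeros, in increasing order, follow the Newton polygon of the coefficients. -/
theorem udEquiv_roots_of_hasLead_coeff {p : ℝ → ℝ[X]} {a b t V : ℝ} {N : ℕ} (ht : 0 < t)
    (hV : 0 < V) (hdeg : ∀ q, (p q).natDegree ≤ N + 1) (hp0 : ∀ q ∈ Set.Ioo (0 : ℝ) 1, p q ≠ 0)
    (hp : ∀ j ≤ N + 1, HasLead (fun q => (p q).coeff j) (leadExp a b (N + 1) j)
      ((V / t) ^ j * V ^ (N + 1 - j))) {E : Fin (N + 1) → ℝ → ℝ}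
    (hE : ∀ q ∈ Set.Ioo (0 : ℝ) 1, StrictMono (fun k => E k q) ∧ ∀ k, (p q).IsRoot (E k q))
    (k : Fin (N + 1)) :
    UDEquiv (E k) (fun q => -(q ^ ((k : ℝ) - N + b - a) * t)) := by
  rw [UDEquiv, Metric.tendsto_nhds]
  intro δ hδ
  set ε := min (δ / 2) (1 / 3) with hεdef
  have hε : 0 < ε := by positivity
  have hε3 : ε ≤ 1 / 3 := min_le_right _ _
  have hεδ : ε < δ := lt_of_le_of_lt (min_le_left _ _) (by linarith)
  have hall := eventually_all.2 fun i =>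
    eventually_exists_root ht hV hdeg hp i hε (by linarith)
  filter_upwards [hall, eventually_mem_Ioo_zero_one,
    Ioo_mem_nhdsGT (show (0 : ℝ) < 1 / 3 by norm_num)] with q hroots hq hq3
  choose x hx hxr using hroots
  have hpos : ∀ s : ℝ, 0 < q ^ s := fun s => Real.rpow_pos_of_pos hq.1 s
  -- Consecutive scales differ by the factor q < 1/3, and x lies in [2/3, 4/3], so the
  -- neighbourhoods of the predicted points do not overlap.
  have hmono : StrictMono fun i : Fin (N + 1) => -x i * (q ^ ((i : ℝ) - N + b - a) * t) := by
    rw [Fin.strictMono_iff_lt_succ]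
    intro i
    have hexp : q ^ (((i.succ : Fin (N + 1)) : ℝ) - N + b - a)
        = q ^ (((i.castSucc : Fin (N + 1)) : ℝ) - N + b - a) * q := by
      rw [← Real.rpow_add_one hq.1.ne']
      congr 1
      simp
      ring
    have hb := (hx i.succ).2
    have ha := (hx i.castSucc).1
    have hlt : x i.succ * q < x i.castSucc := by
      have : x i.succ * q ≤ (1 + ε) * q := mul_le_mul_of_nonneg_right hb hq.1.le
      nlinarith [hq3.2, hq.1]
    have := mul_lt_mul_of_pos_right hlt
      (mul_pos (hpos (((i.castSucc : Fin (N + 1)) : ℝ) - N + b - a)) ht)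
    simp only [hexp]
    linarith
  have heq := congrFun (strictMono_roots_unique (hp0 q hq) (hdeg q) (hE q hq).1 hmono
    (hE q hq).2 hxr) k
  have hne := (mul_pos (hpos ((k : ℝ) - N + b - a)) ht).ne'
  rw [show E k q = _ from heq, Real.dist_eq, neg_mul, neg_div_neg_eq, mul_div_assoc,
    div_self hne, mul_one, abs_lt]
  have := hx k
  exact ⟨by linarith [this.1], by linarith [this.2]⟩

/-! ### Application to the q-Heun recurrence. -/

namespace QHeunParams

variable (P : QHeunParams)

/-- The constant term of `recA`. -/
noncomputable def recA₀ (q : ℝ) (n : ℕ) : ℝ :=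
  q ^ (1 / 2 : ℝ) * (q ^ P.h₁ * P.t₁ + q ^ P.h₂ * P.t₂)
      + (q ^ P.l₁ * P.t₁ + q ^ P.l₂ * P.t₂)
        * q ^ (2 * ((n : ℝ) + P.lam) + P.α₁ + P.α₂ - 5 / 2)

theorem c_eq_ttr (q : ℝ) : ∀ n, P.c q n =
    ttr (fun n => (P.recD q (n + 1))⁻¹ * q ^ ((n : ℝ) + P.lam))
      (fun n => (P.recD q (n + 1))⁻¹ * P.recA₀ q (n + 1))
      (fun n => (P.recD q (n + 1))⁻¹ * P.recB q (n + 1)) n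
  | 0 => by rw [c, ttr]
  | 1 => by
    simp only [c, ttr, recA, recA₀, C_mul]
    simp
    ring
  | n + 2 => by
    rw [c, ttr, c_eq_ttr q (n + 1), c_eq_ttr q n, recA, recA₀,
      show ((n + 2 : ℕ) : ℝ) - 1 = ((n + 1 : ℕ) : ℝ) by push_cast; ring]
    simp only [C_mul]
    ring

variable {P} {N : ℕ}

theorem recD_pos {q : ℝ} (hq : q ∈ Set.Ioo (0 : ℝ) 1) (ht₁ : 0 < P.t₁) (ht₂ : 0 < P.t₂)
    (hβ : P.β < 1) (n : ℕ) : 0 < P.recD q (n + 1) := by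
  have h1 : q ^ (n + 1) < 1 := pow_lt_one₀ hq.1.le hq.2 (by omega)
  have h2 : q ^ (((n + 1 : ℕ) : ℝ) - P.β) < 1 :=
    Real.rpow_lt_one hq.1.le hq.2 (by push_cast; linarith [n.cast_nonneg (α := ℝ)])
  have h3 : 0 < q ^ (P.h₁ + P.h₂) := Real.rpow_pos_of_pos hq.1 _
  exact mul_pos (mul_pos ht₁ ht₂) (mul_pos (mul_pos h3 (sub_pos.2 h1)) (sub_pos.2 h2))

/-- Both exponents, n - 1 - N and n - 1 - N + α₂ - α₁, are negative for n ≤ N, so both factors 1 -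
q^s are negative. -/
theorem recB_pos {q : ℝ} (hq : q ∈ Set.Ioo (0 : ℝ) 1) (hN : (N : ℝ) = -P.lam - P.α₁)
    (hα : P.α₂ - P.α₁ < 1) {n : ℕ} (hn : n < N + 1) : 0 < P.recB q (n + 1) := by
  have hn' : (n : ℝ) ≤ N := by exact_mod_cast Nat.lt_succ_iff.1 hn
  have h1 : 1 < q ^ (((n + 1 : ℕ) : ℝ) - 2 + P.lam + P.α₁) :=
    Real.one_lt_rpow_of_pos_of_lt_one_of_neg hq.1 hq.2 (by push_cast; linarith)
  have h2 : 1 < q ^ (((n + 1 : ℕ) : ℝ) - 2 + P.lam + P.α₂) :=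
    Real.one_lt_rpow_of_pos_of_lt_one_of_neg hq.1 hq.2 (by push_cast; linarith)
  rw [recB, mul_assoc]
  exact mul_pos hq.1 (mul_pos_of_neg_of_neg (by linarith) (by linarith))

theorem hasLead_recD (hβ : P.β < 1) (n : ℕ) :
    HasLead (fun q => P.recD q (n + 1)) (P.h₁ + P.h₂) (P.t₁ * P.t₂) := by
  have hn := n.cast_nonneg (α := ℝ)
  have h1 : HasLead (fun q => 1 - q ^ (n + 1)) 0 1 :=
    (HasLead.one_sub_rpow (s := ((n + 1 : ℕ) : ℝ)) (by positivity)).congr' fun q _ => by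
      rw [Real.rpow_natCast]
  have h2 : HasLead (fun q => 1 - q ^ (((n + 1 : ℕ) : ℝ) - P.β)) 0 1 :=
    HasLead.one_sub_rpow (by push_cast; linarith)
  exact ((HasLead.const (P.t₁ * P.t₂)).mul (((HasLead.rpow (P.h₁ + P.h₂)).mul h1).mul h2)).cast
    (by ring) (by ring)

theorem hasLead_recA₀ (hh : P.h₁ < P.h₂) (hl : P.l₁ < P.l₂) (hc₁ : 1 + P.h₂ - P.l₂ - P.β > 0)
    (n : ℕ) : HasLead (fun q => P.recA₀ q (n + 1)) (1 / 2 + P.h₁) P.t₁ := by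
  have hn := n.cast_nonneg (α := ℝ)
  have h1 := ((HasLead.rpow P.h₁).mul (HasLead.const P.t₁)).cast (add_zero _) (one_mul _)
  have h2 := ((HasLead.rpow P.h₂).mul (HasLead.const P.t₂)).of_lt (e' := P.h₁) (by linarith)
  have h3 := ((HasLead.rpow P.l₁).mul (HasLead.const P.t₁)).cast (add_zero _) (one_mul _)
  have h4 := ((HasLead.rpow P.l₂).mul (HasLead.const P.t₂)).of_lt (e' := P.l₁) (by linarith)
  -- The exponent minus 1/2 + h₁ is 2n + 1 + h₂ - l₂ - β, positive by `hc₁`.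
  have h5 := ((h3.add h4).mul
    (HasLead.rpow (2 * (((n + 1 : ℕ) : ℝ) + P.lam) + P.α₁ + P.α₂ - 5 / 2))).of_lt
      (e' := 1 / 2 + P.h₁) (by rw [lam]; push_cast; linarith)
  exact (((HasLead.rpow (1 / 2)).mul (h1.add h2)).add h5).cast rfl (by ring)

theorem hasLead_recB (hN : (N : ℝ) = -P.lam - P.α₁) (hα : P.α₂ - P.α₁ < 1) {n : ℕ}
    (hn : n < N + 1) : HasLead (fun q => P.recB q (n + 1))
      (2 * n + 1 + P.h₁ + P.h₂ - P.l₁ - P.l₂ - P.β) 1 := by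
  have hn' : (n : ℝ) ≤ N := by exact_mod_cast Nat.lt_succ_iff.1 hn
  have h1 := HasLead.one_sub_rpow_neg (s := ((n + 1 : ℕ) : ℝ) - 2 + P.lam + P.α₁)
    (by push_cast; linarith)
  have h2 := HasLead.one_sub_rpow_neg (s := ((n + 1 : ℕ) : ℝ) - 2 + P.lam + P.α₂)
    (by push_cast; linarith)
  have h3 := (HasLead.rpow 1).mul h1 |>.mul h2
  simp only [Real.rpow_one] at h3
  exact h3.cast (by rw [lam]; push_cast; ring) (by norm_num)

theorem hasLead_coeff_c (hN : (N : ℝ) = -P.lam - P.α₁)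
    (hβ : P.β < 1) (hα : P.α₂ - P.α₁ < 1) (ht₁ : 0 < P.t₁) (ht₂ : 0 < P.t₂)
    (hh : P.h₁ < P.h₂) (hl : P.l₁ < P.l₂) (hc₁ : 1 + P.h₂ - P.l₂ - P.β > 0)
    (hc₂ : 2 + 2 * P.h₂ - P.l₁ - P.l₂ - P.β > 0) {j : ℕ} (hj : j ≤ N + 1) :
    HasLead (fun q => (P.c q (N + 1)).coeff j)
      (leadExp (P.lam - P.h₁ - P.h₂) (1 / 2 - P.h₂) (N + 1) j)
      ((P.t₂⁻¹ / P.t₁) ^ j * P.t₂⁻¹ ^ (N + 1 - j)) := by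
  have hD := fun n => (hasLead_recD hβ n).inv (mul_pos ht₁ ht₂).ne'
  simp only [c_eq_ttr]
  refine (ttr.hasLead_coeff (a := P.lam - P.h₁ - P.h₂) (b := 1 / 2 - P.h₂) (U := P.t₂⁻¹ / P.t₁)
    (V := P.t₂⁻¹) (M := N + 1) (fun n _ => ?_) (fun n _ => ?_) (fun n h1 hn => ?_)
    (N + 1) le_rfl j).cast rfl (if_pos hj)
  · exact ((hD n).mul (HasLead.rpow _)).cast (by ring) (by field_simp)
  · exact ((hD n).mul (hasLead_recA₀ hh hl hc₁ n)).cast (by ring) (by field_simp)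
  · refine ((hD n).mul (hasLead_recB hN hα hn)).of_lt ?_
    -- The exponent of w minus 2b is 2n + 2h₂ - l₁ - l₂ - β; the worst case n = 1 is exactly `hc₂`.
    have : (1 : ℝ) ≤ n := by exact_mod_cast h1
    linarith

/-- The spectral polynomial predicted by the leading asymptotics. -/
theorem spectral_eq_ttr (ht₁ : 0 < P.t₁) (ht₂ : 0 < P.t₂) {q : ℝ} (hq : 0 < q) (N : ℕ) :
    C ((P.t₁ * P.t₂) ^ (-((N : ℝ) + 1)) *
            q ^ (((N : ℝ) / 2 + P.lam - P.h₁ - P.h₂) * ((N : ℝ) + 1))) *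
          ∏ k ∈ Finset.Icc 1 (N + 1),
            (X + C (q ^ ((k : ℝ) - N - 1 / 2 + P.h₁ - P.lam) * P.t₁)) =
    ttr (fun n => (P.t₁ * P.t₂)⁻¹ * q ^ ((n : ℝ) + (P.lam - P.h₁ - P.h₂)))
      (fun _ => P.t₂⁻¹ * q ^ (1 / 2 - P.h₂)) 0 (N + 1) := by
  have hfac : ∀ n : ℕ, C ((P.t₁ * P.t₂)⁻¹ * q ^ ((n : ℝ) + (P.lam - P.h₁ - P.h₂))) * X
        + C (P.t₂⁻¹ * q ^ (1 / 2 - P.h₂))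
      = C ((P.t₁ * P.t₂)⁻¹ * q ^ ((n : ℝ) + (P.lam - P.h₁ - P.h₂))) *
        (X + C (q ^ (1 / 2 - (n : ℝ) + P.h₁ - P.lam) * P.t₁)) := by
    intro n
    rw [mul_add, ← C_mul]
    congr 2
    rw [show 1 / 2 - P.h₂ = ((n : ℝ) + (P.lam - P.h₁ - P.h₂)) + (1 / 2 - (n : ℝ) + P.h₁ - P.lam)
      by ring, Real.rpow_add hq]
    field_simp
  have hconst : ∀ M : ℕ, ∏ n ∈ Finset.range M,
      ((P.t₁ * P.t₂)⁻¹ * q ^ ((n : ℝ) + (P.lam - P.h₁ - P.h₂)))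
        = (P.t₁ * P.t₂) ^ (-(M : ℝ)) *
          q ^ ((((M : ℝ) - 1) / 2 + P.lam - P.h₁ - P.h₂) * (M : ℝ)) := by
    intro M
    induction M with
    | zero => simp
    | succ M ih =>
      rw [Finset.prod_range_succ, ih, mul_mul_mul_comm, ← Real.rpow_add hq,
        ← Real.rpow_neg_one (P.t₁ * P.t₂), ← Real.rpow_add (mul_pos ht₁ ht₂)]
      push_cast
      congr 2 <;> ring
  rw [ttr.eq_prod_of_w_eq_zero]
  simp only [hfac]
  rw [Finset.prod_mul_distrib, ← map_prod, hconst (N + 1)]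
  congr 1
  · push_cast
    ring_nf
  -- The factor of index n in the recurrence is the one with k = N + 1 - n in the product.
  · refine Finset.prod_nbij' (fun k => N + 1 - k) (fun n => N + 1 - n) (fun k hk => ?_)
      (fun n hn => ?_) (fun k hk => ?_) (fun n hn => ?_) fun k hk => ?_
    · rw [Finset.mem_Icc] at hk
      exact Finset.mem_range.2 (by omega)
    · rw [Finset.mem_range] at hn
      exact Finset.mem_Icc.2 (by omega)
    · rw [Finset.mem_Icc] at hk
      omega
    · rw [Finset.mem_range] at hn
      omega
    · rw [Finset.mem_Icc] at hk
      rw [Nat.cast_sub hk.2]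
      push_cast
      congr 4
      ring

end QHeunParams

theorem theorem5p1 (P : QHeunParams) (N : ℕ) (hN : (N : ℝ) = -P.lam - P.α₁)
    (hβ : P.β < 1) (hα : P.α₂ - P.α₁ < 1) (ht₁ : 0 < P.t₁) (ht₂ : 0 < P.t₂)
    (hh : P.h₁ < P.h₂) (hl : P.l₁ < P.l₂)
    (hc₁ : 1 + P.h₂ - P.l₂ - P.β > 0)
    (hc₂ : 2 + 2 * P.h₂ - P.l₁ - P.l₂ - P.β > 0) :
    -- (i) coefficientwise asymptotics of the spectral polynomial
    UDPolyEquiv (N + 1) (fun q => P.c q (N + 1))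
      (fun q => C ((P.t₁ * P.t₂) ^ (-((N : ℝ) + 1)) *
            q ^ (((N : ℝ) / 2 + P.lam - P.h₁ - P.h₂) * ((N : ℝ) + 1))) *
          ∏ k ∈ Finset.Icc 1 (N + 1),
            (X + C (q ^ ((k : ℝ) - N - 1 / 2 + P.h₁ - P.lam) * P.t₁))) ∧
    -- (ii) for 0 < q < 1 the complex roots are N + 1 distinct real numbers, ...
    (∀ q ∈ Set.Ioo (0 : ℝ) 1, ∃ e : Fin (N + 1) → ℝ, StrictMono e ∧
      ∀ z : ℂ, aeval z (P.c q (N + 1)) = 0 ↔ ∃ k, z = (e k : ℂ)) ∧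
    -- ... and the roots listed in increasing order have the stated asymptotics
    (∀ E : Fin (N + 1) → ℝ → ℝ,
      (∀ q ∈ Set.Ioo (0 : ℝ) 1, StrictMono (fun k => E k q) ∧
        ∀ k, (P.c q (N + 1)).IsRoot (E k q)) →
      ∀ k : Fin (N + 1), UDEquiv (E k)
        (fun q => -q ^ (((k : ℕ) : ℝ) + 1 - N - 1 / 2 + P.h₁ - P.lam) * P.t₁)) := by
  have hcoeff := fun {j : ℕ} (hj : j ≤ N + 1) =>
    QHeunParams.hasLead_coeff_c hN hβ hα ht₁ ht₂ hh hl hc₁ hc₂ hj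
  have hupos : ∀ q ∈ Set.Ioo (0 : ℝ) 1, ∀ n < N + 1,
      0 < (P.recD q (n + 1))⁻¹ * q ^ ((n : ℝ) + P.lam) := fun q hq n _ =>
    mul_pos (inv_pos.2 (QHeunParams.recD_pos hq ht₁ ht₂ hβ n)) (Real.rpow_pos_of_pos hq.1 _)
  have hdeg : ∀ q, (P.c q (N + 1)).natDegree ≤ N + 1 := fun q => by
    rw [P.c_eq_ttr]
    exact ttr.natDegree_le _
  refine ⟨⟨fun q hq => ⟨hdeg q, ?_⟩, fun j hj => ?_⟩, fun q hq => ?_, fun E hE k => ?_⟩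
  · beta_reduce
    rw [QHeunParams.spectral_eq_ttr ht₁ ht₂ hq.1]
    exact ttr.natDegree_le _
  · refine (hcoeff hj).udEquiv ?_ (by positivity)
    -- The predicted polynomial obeys the recurrence with w = 0 and the same a, b, U, V, hence has
    -- the same leading terms.
    have h := ttr.hasLead_coeff (a := P.lam - P.h₁ - P.h₂) (b := 1 / 2 - P.h₂)
      (U := P.t₂⁻¹ / P.t₁) (V := P.t₂⁻¹) (M := N + 1)
      (u := fun q n => (P.t₁ * P.t₂)⁻¹ * q ^ ((n : ℝ) + (P.lam - P.h₁ - P.h₂)))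
      (v := fun q _ => P.t₂⁻¹ * q ^ (1 / 2 - P.h₂)) (w := fun _ => 0)
      (fun n _ => ((HasLead.const _).mul (HasLead.rpow _)).cast (by ring) (by field_simp))
      (fun n _ => ((HasLead.const _).mul (HasLead.rpow _)).cast (by ring) (by ring))
      (fun n _ _ => HasLead.zero _) (N + 1) le_rfl j
    refine (h.congr' fun q hq => ?_).cast rfl (if_pos hj)
    beta_reduce
    rw [QHeunParams.spectral_eq_ttr ht₁ ht₂ hq.1]
  · rw [P.c_eq_ttr]
    exact ttr.exists_strictMono_roots (N + 1) (hupos q hq) fun n _ hn =>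
      mul_pos (inv_pos.2 (QHeunParams.recD_pos hq ht₁ ht₂ hβ n))
        (QHeunParams.recB_pos hq hN hα hn)
  · have hp0 : ∀ q ∈ Set.Ioo (0 : ℝ) 1, P.c q (N + 1) ≠ 0 := fun q hq => by
      rw [P.c_eq_ttr]
      exact ttr.ne_zero (hupos q hq)
    convert udEquiv_roots_of_hasLead_coeff ht₁ (inv_pos.2 ht₂) hdeg hp0
      (fun j hj => hcoeff hj) hE k using 2 with q
    rw [neg_mul]
    congr 3
    ring
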